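/- Let $0<n\le m$ be integers, $\mu\ge 1$ a real number and $N>0$ an integer. A lattice $\Lambda\subseteq\mathbb{Z}^m$ is a subgroup of $\mathbb{Z}^m$; $\mathbb{R}^m$ carries the Euclidean norm. A lattice $\mathcal{L}\subseteq\mathbb{Z}^m$ of rank $n$ is called $\mu$-small if it has a basis $v_1,\dots,v_n$ with $\sqrt{\tfrac1n\sum_{i=1}^n\|v_i\|^2}\le\mu$. For lattices $\mathcal{M},\mathcal{L}\subseteq\mathbb{Z}^m$ write $\mathcal{M}\subseteq\mathcal{L}\pmod N$ if for every $v\in\mathcal{M}$ there is $w\in\mathcal{L}$ with $v-w\in(N\mathbb{Z})^m$. Let $$\mathcal{M}^{\perp_N}=\{v\in\mathbb{Z}^m : \langle v,w\rangle\equiv 0 \pmod N \text{ for all } w\in\mathcal{M}+N\mathbb{Z}^m\},$$ a lattice of rank $m$. Let $\lambda_k(\Lambda)$ denote the $k$-th successive minimum of a lattice $\Lambda$ (the least $\rho\geq 0$ such that $\Lambda$ contains $k$ linearly independent vectors of norm at most $\rho$), $\mathrm{Vol}(\Lambda)$ its volume, and $\gamma_d$ Hermite's constant, that is, the supremum of $\lambda_1(\Lambda)^2/\mathrm{Vol}(\Lambda)^{2/d}$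 over all lattices $\Lambda$ of rank $d$ in $\mathbb{R}^d$. Let $\mathcal{M}\subseteq\mathbb{Z}^m$ be a lattice of rank $r$ with $\mathrm{Vol}(\mathcal{M}^{\perp_N})=N^r$. If there exists a $\mu$-small lattice $\mathcal{L}\subseteq\mathbb{Z}^m$ of rank $n$ such that $\mathcal{M}\subseteq\mathcal{L}\pmod N$, then $$\frac{\prod_{k=m-n+1}^{m}\lambda_k(\mathcal{M}^{\perp_N})}{\prod_{k=1}^{m-n}\lambda_k(\mathcal{M}^{\perp_N})}\;\ge\;\gamma_{m-n}^{-(m-n)}\,\frac{N^r}{\mu^{2n}},$$ where for $n=m$ the empty product and the factor $\gamma_0^{-0}$ are both $1$. -/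

import Mathlib

noncomputable section

namespace HiddenLattice

/-- The inclusion of `ℤ^m` into Euclidean space `ℝ^m`. -/
def intEmbedding (m : ℕ) : (Fin m → ℤ) →ₗ[ℤ] EuclideanSpace ℝ (Fin m) where
  toFun v := WithLp.toLp 2 (fun i => (v i : ℝ))
  map_add' v w := by ext i; simp
  map_smul' a v := by ext i; simp

/-- A lattice `Λ ⊆ ℤ^m`, that is, a subgroup of `ℤ^m`, viewed inside Euclidean space `ℝ^m`. -/
def toEuclidean {m : ℕ} (Λ : Submodule ℤ (Fin m → ℤ)) :
    Submodule ℤ (EuclideanSpace ℝ (Fin m)) :=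
  Λ.map (intEmbedding m)

/-- The size `σ(𝔅) = √((1/n) ∑ ‖v‖²)` of a basis `𝔅` with `n` elements, with Euclidean norms. -/
def basisSize {m n : ℕ} {Λ : Submodule ℤ (Fin m → ℤ)} (b : Module.Basis (Fin n) ℤ Λ) : ℝ :=
  Real.sqrt ((1 / (n : ℝ)) * ∑ i, ‖intEmbedding m (b i : Fin m → ℤ)‖ ^ 2)

/-- `Λ` is `μ`-small if it has a basis of size at most `μ`. -/
def IsSmall {m : ℕ} (μ : ℝ) (Λ : Submodule ℤ (Fin m → ℤ)) : Prop :=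
  ∃ b : Module.Basis (Fin (Module.finrank ℤ Λ)) ℤ Λ, basisSize b ≤ μ

/-- `v ∈ Λ (mod N)`: there is `w ∈ Λ` with `v - w ∈ (Nℤ)^m`. -/
def MemMod {m : ℕ} (N : ℤ) (v : Fin m → ℤ) (Λ : Submodule ℤ (Fin m → ℤ)) : Prop :=
  ∃ w ∈ Λ, ∀ i, N ∣ v i - w i

/-- `Λ' ⊆ Λ (mod N)`. -/
def SubsetMod {m : ℕ} (N : ℤ) (Λ' Λ : Submodule ℤ (Fin m → ℤ)) : Prop :=
  ∀ v ∈ Λ', MemMod N v Λ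

/-- The `N`-orthogonal lattice
`Λ^{⊥_N} = {v ∈ ℤ^m | ⟨v, w⟩ ≡ 0 (mod N) for all w ∈ Λ (mod N)}`. -/
def orthogonalMod {m : ℕ} (N : ℤ) (Λ : Submodule ℤ (Fin m → ℤ)) :
    Submodule ℤ (Fin m → ℤ) where
  carrier := {v | ∀ w, MemMod N w Λ → N ∣ v ⬝ᵥ w}
  zero_mem' := by intro w _; simp
  add_mem' := by
    intro a b ha hb w hw
    rw [add_dotProduct]
    exact dvd_add (ha w hw) (hb w hw)
  smul_mem' := by
    intro c a ha w hw
    rw [smul_dotProduct, smul_eq_mul]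
    exact (ha w hw).mul_left c

/-- The `k`-th successive minimum of a lattice in `ℝ^m`: the infimum of the radii `ρ` such that
the lattice contains `k` linearly independent vectors of Euclidean norm at most `ρ`. -/
def successiveMinimum {m : ℕ} (Λ : Submodule ℤ (EuclideanSpace ℝ (Fin m))) (k : ℕ) : ℝ :=
  sInf {ρ : ℝ | 0 ≤ ρ ∧ ∃ v : Fin k → EuclideanSpace ℝ (Fin m),
    (∀ i, v i ∈ Λ) ∧ LinearIndependent ℝ v ∧ ∀ i, ‖v i‖ ≤ ρ}

/-- Hermite's constant `γ_d`: the supremum of `λ₁(Λ)² / Vol(Λ)^{2/d}` over all lattices `Λ` of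
full rank in `ℝ^d`. -/
def hermiteConstant (d : ℕ) : ℝ :=
  sSup {x : ℝ | ∃ Λ : Submodule ℤ (EuclideanSpace ℝ (Fin d)),
    ∃ _ : DiscreteTopology Λ, ∃ _ : IsZLattice ℝ Λ,
      x = successiveMinimum Λ 1 ^ 2 / ZLattice.covolume Λ ^ (2 / (d : ℝ))}

end HiddenLattice

end

namespace HiddenLattice

open MeasureTheory Module Submodule

/-! Put `d = m - n` and let `v_j` be the short basis of `L`. The integer vectors orthogonal to `L`
form a lattice of rank `d` inside `M^{⊥_N}` (`mem_orthogonalMod_of_subsetMod`), with volume at most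
`∏ ‖v_j‖` (`exists_orthogonal_lattice`), hence at most `μ^n` by AM-GM. Minkowski's second theorem
for this sublattice (`IsGreedy.prod_norm_sq_le`) bounds the product `P` of the first `d` minima of
`M^{⊥_N}`: `P² ≤ γ_d^d μ^{2n}`. If `Q` is the product of the other minima, then `P Q ≥ Vol(M^{⊥_N})
= N^r` (`IsGreedy.covolume_le_prod_norm`). Therefore `Q / P = P Q / P² ≥ N^r / (γ_d^d μ^{2n})`.
Minima are handled through greedily chosen vectors, whose norms are exactly the successive minima.
-/

/-! ### Covolumes as determinants, and Hadamard's inequality. -/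

lemma volume_real_fundamentalDomain_orthonormalBasis {d : ℕ}
    (f : OrthonormalBasis (Fin d) ℝ (EuclideanSpace ℝ (Fin d))) :
    (volume : Measure (EuclideanSpace ℝ (Fin d))).real
      (ZSpan.fundamentalDomain f.toBasis) = 1 := by
  rw [measureReal_congr (ZSpan.fundamentalDomain_ae_parallelepiped f.toBasis volume),
    measureReal_def, OrthonormalBasis.coe_toBasis, f.volume_parallelepiped]
  simp

lemma covolume_eq_abs_det {d : ℕ} (Λ : Submodule ℤ (EuclideanSpace ℝ (Fin d)))
    [DiscreteTopology Λ] [IsZLattice ℝ Λ] (b : Basis (Fin d) ℤ Λ)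
    (f : OrthonormalBasis (Fin d) ℝ (EuclideanSpace ℝ (Fin d))) :
    ZLattice.covolume Λ = |f.toBasis.det ((↑) ∘ b)| := by
  rw [ZLattice.covolume_eq_det_mul_measureReal Λ volume b f.toBasis,
    volume_real_fundamentalDomain_orthonormalBasis, mul_one]

lemma covolume_span_range {d : ℕ} (c : Basis (Fin d) ℝ (EuclideanSpace ℝ (Fin d)))
    (f : OrthonormalBasis (Fin d) ℝ (EuclideanSpace ℝ (Fin d))) :
    ZLattice.covolume (span ℤ (Set.range c)) = |f.toBasis.det c| := by
  rw [covolume_eq_abs_det _ (c.restrictScalars ℤ) f]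
  congr 2
  ext i : 1
  simp

/-- The covolume of a lattice is at most the determinant of any independent family in it. -/
lemma covolume_le_abs_det {d : ℕ} (Λ : Submodule ℤ (EuclideanSpace ℝ (Fin d)))
    [DiscreteTopology Λ] [IsZLattice ℝ Λ]
    (f : OrthonormalBasis (Fin d) ℝ (EuclideanSpace ℝ (Fin d)))
    (w : Fin d → EuclideanSpace ℝ (Fin d)) (hw : ∀ i, w i ∈ Λ) (hli : LinearIndependent ℝ w) :
    ZLattice.covolume Λ ≤ |f.toBasis.det w| := by
  have hrank : finrank ℤ Λ = d := by rw [ZLattice.rank ℝ Λ]; simp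
  let b : Basis (Fin d) ℤ Λ := (finBasis ℤ Λ).reindex (finCongr hrank)
  let B := b.ofZLatticeBasis ℝ Λ
  have hB : ((↑) ∘ b : Fin d → EuclideanSpace ℝ (Fin d)) = B := by
    ext i : 1
    exact (b.ofZLatticeBasis_apply ℝ Λ i).symm
  have hmul : f.toBasis.det w = f.toBasis.det B * B.det w := by
    simp only [Basis.det_apply]
    rw [← Matrix.det_mul, Basis.toMatrix_mul_toMatrix]
  -- Lattice vectors have integer coordinates in a lattice basis, so this nonzero determinant has
  -- absolute value at least 1.
  have hint : B.det w = ((Matrix.of fun i j => b.repr ⟨w j, hw j⟩ i).det : ℤ) := by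
    rw [Basis.det_apply, Int.cast_det]
    congr 1
    ext i j
    exact b.ofZLatticeBasis_repr_apply ℝ Λ ⟨w j, hw j⟩ i
  have hne : B.det w ≠ 0 := by
    have := B.isUnit_det (basisOfLinearIndependentOfCardEqFinrank' w hli (by simp))
    simpa using this.ne_zero
  have h1 : 1 ≤ |B.det w| := by
    rw [hint] at hne ⊢
    rw [← Int.cast_abs]
    exact_mod_cast Int.one_le_abs (by exact_mod_cast hne)
  rw [covolume_eq_abs_det Λ b f, hB, hmul, abs_mul]
  exact le_mul_of_one_le_right (abs_nonneg _) h1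

lemma abs_det_le_prod_norm {d : ℕ} {E : Type*} [NormedAddCommGroup E] [InnerProductSpace ℝ E]
    (f : OrthonormalBasis (Fin d) ℝ E) (w : Fin d → E) :
    |f.toBasis.det w| ≤ ∏ i, ‖w i‖ := by
  have : Fact (finrank ℝ E = d) := ⟨by simpa using finrank_eq_card_basis f.toBasis⟩
  rw [← f.toBasis.orientation.volumeForm_robust' f]
  exact f.toBasis.orientation.abs_volumeForm_apply_le w

/-! ### Successive minima and Hermite's constant. -/

lemma bddBelow_successiveMinimum {m : ℕ} (Λ : Submodule ℤ (EuclideanSpace ℝ (Fin m))) (k : ℕ) :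
    BddBelow {ρ : ℝ | 0 ≤ ρ ∧ ∃ v : Fin k → EuclideanSpace ℝ (Fin m),
      (∀ i, v i ∈ Λ) ∧ LinearIndependent ℝ v ∧ ∀ i, ‖v i‖ ≤ ρ} :=
  ⟨0, fun _ h => h.1⟩

lemma successiveMinimum_nonneg {m : ℕ} (Λ : Submodule ℤ (EuclideanSpace ℝ (Fin m))) (k : ℕ) :
    0 ≤ successiveMinimum Λ k :=
  Real.sInf_nonneg fun _ h => h.1

lemma successiveMinimum_le {m k : ℕ} {Λ : Submodule ℤ (EuclideanSpace ℝ (Fin m))} {ρ : ℝ}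
    (hρ : 0 ≤ ρ) (v : Fin k → EuclideanSpace ℝ (Fin m)) (hv : ∀ i, v i ∈ Λ)
    (hli : LinearIndependent ℝ v) (hn : ∀ i, ‖v i‖ ≤ ρ) : successiveMinimum Λ k ≤ ρ :=
  csInf_le (bddBelow_successiveMinimum Λ k) ⟨hρ, v, hv, hli, hn⟩

/-- The family `v` only shows that the set of radii is nonempty; the real `sInf` of the empty set
would be 0. -/
lemma le_successiveMinimum {m k : ℕ} {Λ : Submodule ℤ (EuclideanSpace ℝ (Fin m))} {ρ : ℝ}
    (v : Fin k → EuclideanSpace ℝ (Fin m)) (hv : ∀ i, v i ∈ Λ) (hli : LinearIndependent ℝ v)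
    (h : ∀ u : Fin k → EuclideanSpace ℝ (Fin m), (∀ i, u i ∈ Λ) → LinearIndependent ℝ u →
      ∃ i, ρ ≤ ‖u i‖) : ρ ≤ successiveMinimum Λ k := by
  refine le_csInf ⟨∑ i, ‖v i‖, by positivity, v, hv, hli, fun i => ?_⟩ ?_
  · exact Finset.single_le_sum (f := fun i => ‖v i‖) (fun _ _ => norm_nonneg _)
      (Finset.mem_univ i)
  · rintro x ⟨-, u, hu, hul, hx⟩
    obtain ⟨i, hi⟩ := h u hu hul
    exact hi.trans (hx i)

lemma exists_ne_zero_mem_of_isZLattice {d : ℕ} (hd : 0 < d)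
    (Λ : Submodule ℤ (EuclideanSpace ℝ (Fin d))) [DiscreteTopology Λ] [IsZLattice ℝ Λ] : ∃ x ∈ Λ, x ≠ 0 := by
  by_contra! h
  have hbot : Λ = ⊥ := (Submodule.eq_bot_iff _).2 h
  have htop := IsZLattice.span_top (K := ℝ) (L := Λ)
  have : Nonempty (Fin d) := ⟨⟨0, hd⟩⟩
  rw [hbot] at htop
  simp at htop

lemma le_successiveMinimum_one {d : ℕ} (hd : 0 < d)
    (Λ : Submodule ℤ (EuclideanSpace ℝ (Fin d))) [DiscreteTopology Λ] [IsZLattice ℝ Λ] {ρ : ℝ}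
    (h : ∀ x ∈ Λ, x ≠ 0 → ρ ≤ ‖x‖) : ρ ≤ successiveMinimum Λ 1 := by
  obtain ⟨x, hx, hx0⟩ := exists_ne_zero_mem_of_isZLattice hd Λ
  refine le_successiveMinimum (fun _ => x) (fun _ => hx)
    (LinearIndependent.of_subsingleton 0 hx0) fun u hu hul => ⟨0, h _ (hu 0) (hul.ne_zero 0)⟩

lemma successiveMinimum_one_le_norm {d : ℕ} {Λ : Submodule ℤ (EuclideanSpace ℝ (Fin d))}
    {x : EuclideanSpace ℝ (Fin d)} (hx : x ∈ Λ) (hx0 : x ≠ 0) :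
    successiveMinimum Λ 1 ≤ ‖x‖ :=
  successiveMinimum_le (norm_nonneg _) (fun _ => x) (fun _ => hx)
    (LinearIndependent.of_subsingleton 0 hx0) fun _ => le_rfl

/-- Minkowski's first theorem for balls. -/
lemma volume_ball_successiveMinimum_le {d : ℕ} (hd : 0 < d)
    (Λ : Submodule ℤ (EuclideanSpace ℝ (Fin d))) [DiscreteTopology Λ] [IsZLattice ℝ Λ] :
    successiveMinimum Λ 1 ^ d *
      (volume : Measure (EuclideanSpace ℝ (Fin d))).real (Metric.ball 0 1) ≤
      2 ^ d * ZLattice.covolume Λ := by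
  have hfund := ZLattice.isAddFundamentalDomain (Free.chooseBasis ℤ Λ)
    (volume : Measure (EuclideanSpace ℝ (Fin d)))
  set F := ZSpan.fundamentalDomain ((Free.chooseBasis ℤ Λ).ofZLatticeBasis ℝ) with hF
  have hcov := ZLattice.covolume_eq_measure_fundamentalDomain Λ volume hfund
  have hfin : volume F ≠ ⊤ :=
    (Bornology.IsBounded.measure_lt_top (ZSpan.fundamentalDomain_isBounded _)).ne
  rcases (successiveMinimum_nonneg Λ 1).eq_or_lt with h0 | hpos
  · rw [← h0, zero_pow hd.ne', zero_mul]
    have := (ZLattice.covolume_pos Λ volume).le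
    positivity
  have hball : volume (Metric.ball (0 : EuclideanSpace ℝ (Fin d)) (successiveMinimum Λ 1)) =
      ENNReal.ofReal (successiveMinimum Λ 1 ^ d) * volume (Metric.ball (0 : EuclideanSpace ℝ (Fin d)) 1) := by
    rw [Measure.addHaar_ball_of_pos _ _ hpos]
    simp
  -- Otherwise Minkowski's convex body theorem puts a nonzero lattice point in the open ball of
  -- radius `λ₁`.
  by_contra! hlt
  have hmeas : volume F * 2 ^ finrank ℝ (EuclideanSpace ℝ (Fin d)) <
      volume (Metric.ball (0 : EuclideanSpace ℝ (Fin d)) (successiveMinimum Λ 1)) := by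
    rw [← ENNReal.toReal_lt_toReal (by finiteness) measure_ball_lt_top.ne, hball]
    simp only [ENNReal.toReal_mul, ENNReal.toReal_pow, finrank_euclideanSpace_fin]
    rw [ENNReal.toReal_ofReal (by positivity)]
    rw [hcov] at hlt
    simpa [measureReal_def, mul_comm] using hlt
  have : Countable Λ.toAddSubgroup := inferInstanceAs (Countable Λ)
  obtain ⟨⟨x, hx⟩, hx0, hxball⟩ :=
    exists_ne_zero_mem_lattice_of_measure_mul_two_pow_lt_measure (L := Λ.toAddSubgroup) hfund
      (by simp) (convex_ball _ _) hmeas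
  have hle := successiveMinimum_one_le_norm (Λ := Λ) (x := x) hx (by simpa using hx0)
  simp at hxball
  linarith

/-- Needed for `hermiteConstant` to dominate each quotient: the real `sSup` of an unbounded set is
0. -/
lemma bddAbove_hermite {d : ℕ} (hd : 0 < d) :
    BddAbove {x : ℝ | ∃ Λ : Submodule ℤ (EuclideanSpace ℝ (Fin d)),
      ∃ _ : DiscreteTopology Λ, ∃ _ : IsZLattice ℝ Λ,
      x = successiveMinimum Λ 1 ^ 2 / ZLattice.covolume Λ ^ (2 / (d : ℝ))} := by
  set β := (volume : Measure (EuclideanSpace ℝ (Fin d))).real (Metric.ball 0 1) with hβ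
  have hβpos : 0 < β := 
    ENNReal.toReal_pos (Metric.measure_ball_pos _ _ one_pos).ne' measure_ball_lt_top.ne
  refine ⟨(2 ^ d / β) ^ (2 / (d : ℝ)), ?_⟩
  rintro x ⟨Λ, _, _, rfl⟩
  have hV := ZLattice.covolume_pos Λ volume
  have hl := successiveMinimum_nonneg Λ 1
  rw [div_le_iff₀ (by positivity), ← Real.mul_rpow (by positivity) hV.le]
  have h := volume_ball_successiveMinimum_le hd Λ
  have h2 : successiveMinimum Λ 1 ^ d ≤ 2 ^ d / β * ZLattice.covolume Λ := by
    rw [div_mul_eq_mul_div, le_div_iff₀ hβpos]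
    exact h
  have hd' : (d : ℝ) ≠ 0 := by positivity
  calc successiveMinimum Λ 1 ^ 2 = (successiveMinimum Λ 1 ^ d) ^ (2 / (d : ℝ)) := by
        rw [← Real.rpow_natCast _ d, ← Real.rpow_mul hl, mul_div_cancel₀ _ hd']
        norm_num
    _ ≤ _ := Real.rpow_le_rpow (by positivity) h2 (by positivity)

/-- Hermite's inequality, in terms of any lower bound for the norms of nonzero vectors. -/
lemma one_le_hermiteConstant_pow_mul {d : ℕ} (hd : 0 < d)
    (c : Basis (Fin d) ℝ (EuclideanSpace ℝ (Fin d)))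
    (f : OrthonormalBasis (Fin d) ℝ (EuclideanSpace ℝ (Fin d)))
    (h : ∀ x ∈ span ℤ (Set.range c), x ≠ 0 → 1 ≤ ‖x‖) :
    1 ≤ hermiteConstant d ^ d * f.toBasis.det c ^ 2 := by
  have h1 := le_successiveMinimum_one hd _ h
  have hle : successiveMinimum (span ℤ (Set.range c)) 1 ^ 2 /
      ZLattice.covolume (span ℤ (Set.range c)) ^ (2 / (d : ℝ)) ≤ hermiteConstant d :=
    le_csSup (bddAbove_hermite hd) ⟨_, inferInstance, inferInstance, rfl⟩
  have hV := ZLattice.covolume_pos (span ℤ (Set.range c)) volume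
  rw [div_le_iff₀ (by positivity)] at hle
  have h2 : 1 ≤ hermiteConstant d *
      ZLattice.covolume (span ℤ (Set.range c)) ^ (2 / (d : ℝ)) :=
    le_trans (one_le_pow₀ h1) hle
  refine (one_le_pow₀ h2 (n := d)).trans_eq ?_
  have hd' : (d : ℝ) ≠ 0 := by positivity
  rw [mul_pow, ← Real.rpow_natCast (_ ^ _) d, ← Real.rpow_mul hV.le, div_mul_cancel₀ _ hd',
    covolume_span_range c f]
  norm_num

/-! ### Greedy families and successive minima. -/

/-- The first `k` terms of `w` are chosen greedily in `Λ`: each is a shortest vector of `Λ` outside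
the span of the previous ones. -/
def IsGreedy {E : Type*} [NormedAddCommGroup E] [NormedSpace ℝ E] (Λ : Submodule ℤ E) (k : ℕ)
    (w : ℕ → E) : Prop :=
  ∀ i < k, w i ∈ Λ ∧ w i ∉ span ℝ (w '' Set.Iio i) ∧
    ∀ x ∈ Λ, x ∉ span ℝ (w '' Set.Iio i) → ‖w i‖ ≤ ‖x‖

section Greedy

variable {E : Type*} [NormedAddCommGroup E] [NormedSpace ℝ E] {Λ : Submodule ℤ E} {k : ℕ}
  {w : ℕ → E}

lemma IsGreedy.linearIndepOn (h : IsGreedy Λ k w) : LinearIndepOn ℝ w (Set.Iio k) := by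
  induction k with
  | zero => simp
  | succ k ih =>
    have : Set.Iio (k + 1) = insert k (Set.Iio k) := by ext; simp
    rw [this]
    exact (ih fun i hi => h i (by omega)).insert (h k (by omega)).2.1

lemma IsGreedy.linearIndependent (h : IsGreedy Λ k w) :
    LinearIndependent ℝ fun i : Fin k => w i :=
  LinearIndependent.comp h.linearIndepOn (fun i : Fin k => (⟨i, i.2⟩ : Set.Iio k))
    fun _ _ hij => Fin.ext (congrArg Subtype.val hij)

lemma IsGreedy.mono (h : IsGreedy Λ k w) {j : ℕ} (hj : j ≤ k) : IsGreedy Λ j w :=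
  fun i hi => h i (by omega)

lemma IsGreedy.norm_le (h : IsGreedy Λ k w) {i j : ℕ} (hij : i ≤ j) (hj : j < k) :
    ‖w i‖ ≤ ‖w j‖ :=
  (h i (by omega)).2.2 _ (h j hj).1 fun hmem =>
    (h j hj).2.1 (span_mono (Set.image_mono (Set.Iio_subset_Iio hij)) hmem)

lemma IsGreedy.norm_pos (h : IsGreedy Λ k w) {i : ℕ} (hi : i < k) : 0 < ‖w i‖ := by
  rw [norm_pos_iff]
  intro h0
  exact (h i hi).2.1 (h0 ▸ zero_mem _)

lemma finrank_span_image_Iio_le (w : ℕ → E) (k : ℕ) :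
    finrank ℝ (span ℝ (w '' Set.Iio k)) ≤ k := by
  classical
  have : w '' Set.Iio k = (((Finset.range k).image w : Finset _) : Set _) := by
    ext; simp
  rw [this]
  exact (finrank_span_finset_le_card _).trans (Finset.card_image_le.trans (by simp))

lemma exists_isGreedy [FiniteDimensional ℝ E] (Λ : Submodule ℤ E) [DiscreteTopology Λ]
    (hΛ : span ℝ (Λ : Set E) = ⊤) : ∀ k ≤ finrank ℝ E, ∃ w, IsGreedy Λ k w := by
  intro k
  induction k with
  | zero => exact fun _ => ⟨fun _ => 0, fun i hi => absurd hi (by omega)⟩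
  | succ k ih =>
    intro hk
    obtain ⟨w, hw⟩ := ih (by omega)
    have hne : span ℝ (w '' Set.Iio k) ≠ ⊤ := by
      intro htop
      have h1 := finrank_span_image_Iio_le w k
      rw [htop, finrank_top] at h1
      omega
    have hex : ∃ x ∈ Λ, x ∉ span ℝ (w '' Set.Iio k) := by
      by_contra! hall
      exact hne (top_le_iff.1 (hΛ ▸ span_le.2 hall))
    obtain ⟨x₀, hx₀, hx₀'⟩ := hex
    -- By discreteness only finitely many lattice vectors compete with `x₀`, so the minimum is
    -- attained.
    have hfin : (Metric.closedBall (0 : E) ‖x₀‖ ∩ (Λ : Set E)).Finite :=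
      Metric.finite_isBounded_inter_isClosed DiscreteTopology.isDiscrete
        Metric.isBounded_closedBall (AddSubgroup.isClosed_of_discrete (H := Λ.toAddSubgroup))
    have hfin' : {x ∈ Metric.closedBall (0 : E) ‖x₀‖ ∩ (Λ : Set E) |
      x ∉ span ℝ (w '' Set.Iio k)}.Finite := hfin.subset (Set.sep_subset _ _)
    obtain ⟨x, ⟨⟨-, hxΛ⟩, hxs⟩, hxmin⟩ := Set.exists_min_image _ (fun x => ‖x‖) hfin'
      ⟨x₀, ⟨by simp, hx₀⟩, hx₀'⟩
    have himg : ∀ i ≤ k, Function.update w k x '' Set.Iio i = w '' Set.Iio i := fun i hi =>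
      Set.image_congr fun j hj =>
        Function.update_of_ne (by have : j < i := hj; omega) _ _
    refine ⟨Function.update w k x, fun i hi => ?_⟩
    rw [himg i (by omega)]
    rcases (Nat.lt_succ_iff_lt_or_eq.1 hi) with hlt | rfl
    · rw [Function.update_of_ne hlt.ne]
      exact hw i hlt
    · rw [Function.update_self]
      refine ⟨hxΛ, hxs, fun y hy hys => ?_⟩
      rcases le_total ‖y‖ ‖x₀‖ with hle | hle
      · exact hxmin y ⟨⟨by simpa using hle, hy⟩, hys⟩
      · exact (hxmin x₀ ⟨⟨by simp, hx₀⟩, hx₀'⟩).trans hle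

end Greedy

lemma IsGreedy.successiveMinimum_eq {m k : ℕ} {Λ : Submodule ℤ (EuclideanSpace ℝ (Fin m))}
    {w : ℕ → EuclideanSpace ℝ (Fin m)} (h : IsGreedy Λ (k + 1) w) :
    successiveMinimum Λ (k + 1) = ‖w k‖ := by
  refine le_antisymm ?_ ?_
  · exact successiveMinimum_le (norm_nonneg _) (fun i => w i) (fun i => (h i i.2).1)
      h.linearIndependent fun i => h.norm_le (by omega) (by omega)
  · refine le_successiveMinimum (fun i => w i) (fun i => (h i i.2).1)
      h.linearIndependent fun u hu hul => ?_
    by_contra! hlt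
    -- Vectors shorter than `w k` lie in the span of the `k` earlier choices, which has no room for
    -- `k + 1` independent ones.
    have hsub : span ℝ (Set.range u) ≤ span ℝ (w '' Set.Iio k) := by
      rw [span_le]
      rintro _ ⟨i, rfl⟩
      by_contra hmem
      exact absurd ((h k (by omega)).2.2 _ (hu i) hmem) (not_le.2 (hlt i))
    have h1 := finrank_mono hsub
    rw [finrank_span_eq_card hul, Fintype.card_fin] at h1
    have h2 := finrank_span_image_Iio_le w k
    omega

/-! ### Minkowski's second theorem. -/

/-- Minkowski's second theorem, with Hermite's constant. -/
lemma IsGreedy.prod_norm_sq_le {d : ℕ} {E : Type*} [NormedAddCommGroup E]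
    [InnerProductSpace ℝ E] (f : OrthonormalBasis (Fin d) ℝ E) (c : Basis (Fin d) ℝ E)
    {w : ℕ → E} (h : IsGreedy (span ℤ (Set.range c)) d w) :
    (∏ i : Fin d, ‖w i‖) ^ 2 ≤ hermiteConstant d ^ d * f.toBasis.det c ^ 2 := by
  rcases Nat.eq_zero_or_pos d with rfl | hd
  · simp
  have hrank : finrank ℝ E = Fintype.card (Fin d) := finrank_eq_card_basis c
  have : FiniteDimensional ℝ E := c.finiteDimensional_of_finite
  let e := InnerProductSpace.gramSchmidtOrthonormalBasis hrank fun i : Fin d => w i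
  have hunit : ∀ i : Fin d, IsUnit ‖w i‖ := fun i => (h.norm_pos i.2).ne'.isUnit
  let e' := e.toBasis.isUnitSMul hunit
  let s := EuclideanSpace.basisFun (Fin d) ℝ
  -- With `e` the Gram-Schmidt basis of `w`, `T` divides the `i`-th coordinate by `‖w i‖`. It
  -- divides volume by `∏ ‖w i‖`, yet leaves no nonzero lattice vector shorter than 1.
  let T : E ≃ₗ[ℝ] EuclideanSpace ℝ (Fin d) := e'.equiv s.toBasis (Equiv.refl _)
  have hTs : e'.map T = s.toBasis := by
    ext1 i
    simp [T]
  have hTx : ∀ x, ‖T x‖ ^ 2 = ∑ i : Fin d, (‖w i‖⁻¹ * inner ℝ (e i) x) ^ 2 := by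
    intro x
    have hx : T x = ∑ i, e'.repr x i • s i := by
      conv_lhs => rw [← e'.sum_repr x, map_sum]
      exact Finset.sum_congr rfl fun i _ => by
        rw [map_smul, Basis.equiv_apply, OrthonormalBasis.coe_toBasis, Equiv.refl_apply]
    rw [EuclideanSpace.norm_sq_eq]
    refine Finset.sum_congr rfl fun i _ => ?_
    have : T x i = e'.repr x i := by
      rw [hx]
      simp [s, Pi.single_apply]
    rw [this, Basis.repr_isUnitSMul, OrthonormalBasis.coe_toBasis_repr_apply,
      OrthonormalBasis.repr_apply_apply, Real.norm_eq_abs, sq_abs, Units.smul_def]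
    simp
  have hlow : ∀ x ∈ span ℤ (Set.range (c.map T)), x ≠ 0 → 1 ≤ ‖x‖ := by
    intro y hy hy0
    have hy' : ∃ x ∈ span ℤ (Set.range c), T x = y := by
      have hr : Set.range (c.map T) = (T.toLinearMap.restrictScalars ℤ) '' Set.range c := by
        rw [← Set.range_comp]
        congr 1
      rw [hr, span_image] at hy
      simpa using hy
    obtain ⟨x, hx, rfl⟩ := hy'
    have hx0 : 0 < ‖x‖ := norm_pos_iff.2 fun h0 => hy0 (by rw [h0, map_zero])
    -- If `‖w i‖ > ‖x‖`, greediness puts `x` in the span of the earlier `w j`, so its `i`-th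
    -- coordinate vanishes; otherwise dividing by `‖w i‖` shrinks less than dividing by `‖x‖`.
    have hterm : ∀ i : Fin d,
        (‖x‖⁻¹ * inner ℝ (e i) x) ^ 2 ≤ (‖w i‖⁻¹ * inner ℝ (e i) x) ^ 2 := by
      intro i
      by_cases hle : ‖w i‖ ≤ ‖x‖
      · have := h.norm_pos i.2
        rw [mul_pow, mul_pow]
        gcongr
      · have hmem : x ∈ span ℝ (w '' Set.Iio (i : ℕ)) := by
          by_contra hmem
          exact hle ((h i i.2).2.2 x hx hmem)
        have hzero : inner ℝ (e i) x = 0 := by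
          have hker : span ℝ (w '' Set.Iio (i : ℕ)) ≤ LinearMap.ker (innerₛₗ ℝ (e i)) := by
            rw [span_le]
            rintro _ ⟨j, hj, rfl⟩
            have hj' : j < i := hj
            exact InnerProductSpace.gramSchmidtOrthonormalBasis_inv_triangular hrank (fun i : Fin d => w i)
              (show (⟨j, by omega⟩ : Fin d) < i from hj')
          exact hker hmem
        simp [hzero]
    have hsum : (1 : ℝ) = ∑ i : Fin d, (‖x‖⁻¹ * inner ℝ (e i) x) ^ 2 := by
      simp_rw [mul_pow]
      rw [← Finset.mul_sum, e.sum_sq_inner_right, ← mul_pow, inv_mul_cancel₀ hx0.ne', one_pow]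
    have hsq : (1 : ℝ) ≤ ‖T x‖ ^ 2 := by
      rw [hTx, hsum]
      exact Finset.sum_le_sum fun i _ => hterm i
    nlinarith [norm_nonneg (T x)]
  have h1 := one_le_hermiteConstant_pow_mul hd (c.map T) s hlow
  have hdet : s.toBasis.det (c.map T) = e'.det c := by
    rw [← hTs, Basis.det_map]
    congr 1
    ext1 i
    simp
  have hmul : e.toBasis.det c = e.toBasis.det e' * e'.det c := by
    simp only [Basis.det_apply]
    rw [← Matrix.det_mul, Basis.toMatrix_mul_toMatrix]
  have he' : e.toBasis.det e' = ∏ i : Fin d, ‖w i‖ := by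
    simp [e', Basis.det_isUnitSMul]
  have hfe : f.toBasis.det c ^ 2 = e.toBasis.det c ^ 2 := by
    have : f.toBasis.det c = f.toBasis.det e.toBasis * e.toBasis.det c := by
      simp only [Basis.det_apply]
      rw [← Matrix.det_mul, Basis.toMatrix_mul_toMatrix]
    rw [this, mul_pow]
    rcases f.det_to_matrix_orthonormalBasis_real e with h | h <;> simp [h]
  rw [hdet] at h1
  rw [hfe, hmul, he', mul_pow, mul_left_comm]
  exact le_mul_of_one_le_right (by positivity) h1

/-! ### The integer vectors orthogonal to a given family. -/

lemma inner_intEmbedding {m : ℕ} (v w : Fin m → ℤ) :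
    inner ℝ (intEmbedding m v) (intEmbedding m w) = ((v ⬝ᵥ w : ℤ) : ℝ) := by
  simp [intEmbedding, PiLp.inner_apply, dotProduct, mul_comm]

lemma det_mul_det_eq_det_inner {ι E : Type*} [Fintype ι] [DecidableEq ι] [NormedAddCommGroup E]
    [InnerProductSpace ℝ E] (s : OrthonormalBasis ι ℝ E) (F G : ι → E) :
    s.toBasis.det F * s.toBasis.det G = (Matrix.of fun i j => inner ℝ (F i) (G j)).det := by
  rw [Basis.det_apply, Basis.det_apply, ← Matrix.det_transpose, ← Matrix.det_mul]
  congr 1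
  ext i j
  simp only [Matrix.mul_apply, Matrix.transpose_apply, Basis.toMatrix_apply,
    OrthonormalBasis.coe_toBasis_repr_apply, OrthonormalBasis.repr_apply_apply, Matrix.of_apply]
  rw [← s.sum_inner_mul_inner]
  exact Finset.sum_congr rfl fun k _ => by rw [real_inner_comm]

lemma abs_det_le_prod_norm' {ι E : Type*} [Fintype ι] [DecidableEq ι] [NormedAddCommGroup E]
    [InnerProductSpace ℝ E] (f : OrthonormalBasis ι ℝ E) (w : ι → E) :
    |f.toBasis.det w| ≤ ∏ i, ‖w i‖ := by
  let g := Fintype.equivFin ι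
  have h := abs_det_le_prod_norm (f.reindex g) (w ∘ g.symm)
  rw [OrthonormalBasis.reindex_toBasis, Basis.det_reindex, Function.comp_assoc,
    Equiv.symm_comp_self, Function.comp_id] at h
  exact h.trans_eq (g.symm.prod_comp fun i => ‖w i‖)

/-- A `ℤ`-basis of a finite free module adapted to the kernel of a linear map with free range. -/
lemma exists_basis_adapted_ker {V V' ι κ : Type*} [AddCommGroup V] [AddCommGroup V']
    (φ : V →ₗ[ℤ] V') (bK : Basis ι ℤ (LinearMap.ker φ)) (bR : Basis κ ℤ (LinearMap.range φ)) :
    ∃ B : Basis (ι ⊕ κ) ℤ V, (∀ i, B (Sum.inl i) = bK i) ∧ ∀ j, φ (B (Sum.inr j)) = bR j := by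
  have : Module.Free ℤ (LinearMap.range φ) := .of_basis bR
  -- A section of `φ` onto its free range splits `V` as kernel plus range.
  obtain ⟨g, hg⟩ := Module.projective_lifting_property φ.rangeRestrict LinearMap.id
    φ.surjective_rangeRestrict
  have hg' : ∀ r, φ (g r) = r := fun r => by
    have := LinearMap.congr_fun hg r
    exact congrArg Subtype.val this
  let T := (LinearMap.ker φ).subtype.coprod g
  have hT : Function.Bijective T := by
    constructor
    · rw [← LinearMap.ker_eq_bot, LinearMap.ker_eq_bot']
      rintro ⟨k, r⟩ h
      have h' : (k : V) + g r = 0 := h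
      have h2 := congrArg φ h'
      rw [map_add, hg', LinearMap.mem_ker.1 k.2, zero_add, map_zero] at h2
      have hr : r = 0 := Subtype.ext h2
      rw [hr, map_zero, add_zero] at h'
      exact Prod.ext (Subtype.ext h') hr
    · intro x
      refine ⟨(⟨x - g (φ.rangeRestrict x), ?_⟩, φ.rangeRestrict x), ?_⟩
      · rw [LinearMap.mem_ker, map_sub, hg']
        simp
      · simp [T]
  refine ⟨(bK.prod bR).map (LinearEquiv.ofBijective T hT), fun i => ?_, fun j => ?_⟩
  · simp [T]
  · simp [T, hg']

lemma abs_det_intEmbedding_basis {m : ℕ} {ι : Type*} [Fintype ι] [DecidableEq ι]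
    (e : Fin m ≃ ι) (B : Basis ι ℤ (Fin m → ℤ)) :
    |((EuclideanSpace.basisFun (Fin m) ℝ).reindex e).toBasis.det (intEmbedding m ∘ B)| = 1 := by
  have hunit := ((Pi.basisFun ℤ (Fin m)).reindex e).isUnit_det B
  rw [Int.isUnit_iff_abs_eq] at hunit
  have : ((EuclideanSpace.basisFun (Fin m) ℝ).reindex e).toBasis.det (intEmbedding m ∘ B) =
      ((((Pi.basisFun ℤ (Fin m)).reindex e).det B : ℤ) : ℝ) := by
    rw [Basis.det_apply, Basis.det_apply, Int.cast_det]
    congr 1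
  rw [this, ← Int.cast_abs, hunit, Int.cast_one]

lemma one_le_abs_det_intCast {ι : Type*} [Fintype ι] [DecidableEq ι]
    (u : ι → ι → ℤ) (hu : LinearIndependent ℤ u) :
    1 ≤ |(Matrix.of fun i j => (u j i : ℝ)).det| := by
  have h : (Matrix.of fun i j => (u j i : ℝ)).det =
      ((Matrix.of fun i j => u j i).det : ℤ) := by
    rw [Int.cast_det]; rfl
  rw [h, ← Int.cast_abs]
  have hne : (Matrix.of fun i j => u j i).det ≠ 0 := by
    intro h0
    obtain ⟨x, hx0, hx⟩ := Matrix.exists_mulVec_eq_zero_iff.2 h0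
    refine hx0 (funext fun i => ?_)
    refine Fintype.linearIndependent_iff.1 hu x ?_ i
    ext k
    have := congrFun hx k
    simpa [Matrix.mulVec, dotProduct, mul_comm] using this
  exact_mod_cast Int.one_le_abs hne

lemma finrank_range_of_linearIndependent {m n : ℕ} (v : Fin n → Fin m → ℤ)
    (hv : LinearIndependent ℤ v) :
    finrank ℤ (LinearMap.range (Matrix.of v).mulVecLin) = n := by
  refine le_antisymm ?_ ?_
  · simpa using (LinearMap.range (Matrix.of v).mulVecLin).finrank_le
  · have hli : LinearIndependent ℤ ((Matrix.of v).mulVecLin.rangeRestrict ∘ v) := by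
      rw [Fintype.linearIndependent_iff]
      intro c hc
      refine Fintype.linearIndependent_iff.1 hv c ?_
      set x := ∑ i, c i • v i with hx
      have hker : (Matrix.of v).mulVec x = 0 := by
        change (Matrix.of v).mulVecLin x = 0
        rw [hx, map_sum]
        simp_rw [map_smul]
        simpa using congrArg Subtype.val hc
      -- `x` is a combination of the `v i` and orthogonal to each of them.
      have hself : x ⬝ᵥ x = 0 := by
        conv_lhs => lhs; rw [hx]
        rw [sum_dotProduct]
        refine Finset.sum_eq_zero fun i _ => ?_
        rw [smul_dotProduct]
        have := congrFun hker i
        simp only [Matrix.mulVec, Matrix.of_apply, Pi.zero_apply] at this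
        rw [this, smul_zero]
      exact dotProduct_self_eq_zero.1 hself
    simpa using hli.fintype_card_le_finrank

/-- The lattice of integer vectors orthogonal to `v` has determinant at most `∏ ‖v j‖`. -/
lemma exists_orthogonal_lattice {m n : ℕ} (v : Fin n → Fin m → ℤ) (hv : LinearIndependent ℤ v) :
    ∃ (W : Submodule ℝ (EuclideanSpace ℝ (Fin m))) (f : OrthonormalBasis (Fin (m - n)) ℝ W)
      (c : Basis (Fin (m - n)) ℝ W) (a : Fin (m - n) → Fin m → ℤ),
      (∀ i, (c i : EuclideanSpace ℝ (Fin m)) = intEmbedding m (a i)) ∧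
      (∀ i j, v j ⬝ᵥ a i = 0) ∧
      |f.toBasis.det c| ≤ ∏ j, ‖intEmbedding m (v j)‖ := by
  classical
  set φ := (Matrix.of v).mulVecLin with hφ
  have hnm : n ≤ m := by simpa using hv.fintype_card_le_finrank
  have hR := finrank_range_of_linearIndependent v hv
  have hK : finrank ℤ (LinearMap.ker φ) = m - n := by
    have := (LinearMap.ker φ).finrank_quotient_add_finrank
    rw [φ.quotKerEquivRange.finrank_eq, hR, finrank_fin_fun] at this
    omega
  obtain ⟨B, hBl, hBr⟩ := exists_basis_adapted_ker φ
    ((finBasis ℤ (LinearMap.ker φ)).reindex (finCongr hK))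
    ((finBasis ℤ (LinearMap.range φ)).reindex (finCongr hR))
  set bR := (finBasis ℤ (LinearMap.range φ)).reindex (finCongr hR)
  set a : Fin (m - n) → Fin m → ℤ := fun i => B (Sum.inl i) with ha
  have hva : ∀ i j, v j ⬝ᵥ a i = 0 := by
    intro i j
    have : φ (a i) = 0 := by
      rw [ha]
      dsimp only
      rw [hBl]
      exact LinearMap.mem_ker.1 (Subtype.prop _)
    exact congrFun this j
  let e : Fin m ≃ Fin (m - n) ⊕ Fin n := (finCongr (by omega)).trans finSumFinEquiv.symm
  let s := (EuclideanSpace.basisFun (Fin m) ℝ).reindex e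
  have hG : |s.toBasis.det (intEmbedding m ∘ B)| = 1 := abs_det_intEmbedding_basis e B
  have hGli : LinearIndependent ℝ (intEmbedding m ∘ B) := by
    refine (s.toBasis.is_basis_iff_det.2 ?_).1
    rw [isUnit_iff_ne_zero]
    intro h0
    simp [h0] at hG
  have hali : LinearIndependent ℝ fun i => intEmbedding m (a i) :=
    hGli.comp Sum.inl Sum.inl_injective
  let c := Basis.span hali
  let f := (stdOrthonormalBasis ℝ (span ℝ (Set.range fun i => intEmbedding m (a i)))).reindex
    (finCongr ((finrank_eq_card_basis c).trans (Fintype.card_fin _)))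
  have hc : ∀ i, (c i : EuclideanSpace ℝ (Fin m)) = intEmbedding m (a i) :=
    fun i => congrArg Subtype.val (Basis.span_apply hali i)
  refine ⟨_, f, c, a, hc, hva, ?_⟩
  let F : Fin (m - n) ⊕ Fin n → EuclideanSpace ℝ (Fin m) :=
    Sum.elim (fun i => (f i : EuclideanSpace ℝ (Fin m))) fun j => intEmbedding m (v j)
  -- The zero block is `v i ⊥ a j`. The lower right block is a nonsingular integer matrix, so its
  -- determinant only helps: `|det c| ≤ |det F|`, and Hadamard applies to `F`, whose `f i` are unit
  -- vectors.
  have hblock : (Matrix.of fun i j => inner ℝ (F i) ((intEmbedding m ∘ B) j)) =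
      Matrix.fromBlocks (f.toBasis.toMatrix c)
        (Matrix.of fun i j => inner ℝ (f i : EuclideanSpace ℝ (Fin m))
          (intEmbedding m (B (Sum.inr j))))
        0 (Matrix.of fun i j => ((bR j : Fin n → ℤ) i : ℝ)) := by
    ext i j
    rcases i with i | i <;> rcases j with j | j
    · simp only [Matrix.of_apply, Matrix.fromBlocks_apply₁₁, Basis.toMatrix_apply,
        OrthonormalBasis.coe_toBasis_repr_apply, OrthonormalBasis.repr_apply_apply, coe_inner, hc]
      rfl
    · rfl
    · simp only [Matrix.of_apply, Matrix.fromBlocks_apply₂₁, Matrix.zero_apply]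
      change inner ℝ (intEmbedding m (v i)) (intEmbedding m (a j)) = 0
      rw [inner_intEmbedding, hva, Int.cast_zero]
    · simp only [Matrix.of_apply, Matrix.fromBlocks_apply₂₂]
      change inner ℝ (intEmbedding m (v i)) (intEmbedding m (B (Sum.inr j))) = _
      rw [inner_intEmbedding, ← hBr]
      rfl
  have hdet := det_mul_det_eq_det_inner s F (intEmbedding m ∘ B)
  rw [hblock, Matrix.det_fromBlocks_zero₂₁, ← Basis.det_apply] at hdet
  have hE := one_le_abs_det_intCast (fun j => (bR j : Fin n → ℤ))
    (bR.linearIndependent.map' (LinearMap.range φ).subtype (ker_subtype _))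
  have habs := congrArg abs hdet
  rw [abs_mul, abs_mul, hG, mul_one] at habs
  calc |f.toBasis.det c| ≤ |s.toBasis.det F| := by
        rw [habs]
        exact le_mul_of_one_le_right (abs_nonneg _) hE
    _ ≤ ∏ i, ‖F i‖ := abs_det_le_prod_norm' s F
    _ = ∏ j, ‖intEmbedding m (v j)‖ := by
        rw [Fintype.prod_sum_type]
        have : ∀ i, ‖F (Sum.inl i)‖ = 1 := fun i => f.orthonormal.1 i
        rw [Finset.prod_eq_one fun i _ => this i, one_mul]
        rfl

/-! ### The lattice `M^{⊥_N}` and the size of a small basis. -/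

instance discreteTopology_toEuclidean {m : ℕ} (Λ : Submodule ℤ (Fin m → ℤ)) :
    DiscreteTopology (toEuclidean Λ) := by
  have hsub : (toEuclidean Λ : Set (EuclideanSpace ℝ (Fin m))) ⊆
      span ℤ (Set.range (EuclideanSpace.basisFun (Fin m) ℝ).toBasis) := by
    rintro _ ⟨v, -, rfl⟩
    have : intEmbedding m v = ∑ i, v i • (EuclideanSpace.basisFun (Fin m) ℝ).toBasis i := by
      ext j
      simp [intEmbedding, Pi.single_apply]
    rw [this]
    exact sum_mem fun i _ => smul_mem _ _ (subset_span ⟨i, rfl⟩)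
  exact DiscreteTopology.of_subset (t := (toEuclidean Λ : Set (EuclideanSpace ℝ (Fin m))))
    (inferInstanceAs (DiscreteTopology
      (span ℤ (Set.range (EuclideanSpace.basisFun (Fin m) ℝ).toBasis)))) hsub

lemma isZLattice_toEuclidean_orthogonalMod {m : ℕ} {N : ℤ} (hN : 0 < N)
    (M : Submodule ℤ (Fin m → ℤ)) : IsZLattice ℝ (toEuclidean (orthogonalMod N M)) := by
  refine ⟨top_le_iff.1 ?_⟩
  rw [← (EuclideanSpace.basisFun (Fin m) ℝ).toBasis.span_eq, span_le]
  rintro _ ⟨i, rfl⟩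
  have hmem : intEmbedding m (N • Pi.single i 1) ∈ toEuclidean (orthogonalMod N M) := by
    refine mem_map_of_mem fun w _ => ?_
    rw [smul_dotProduct, smul_eq_mul]
    exact dvd_mul_right _ _
  have hN' : (N : ℝ) ≠ 0 := by exact_mod_cast hN.ne'
  have heq : (EuclideanSpace.basisFun (Fin m) ℝ).toBasis i =
      (N : ℝ)⁻¹ • intEmbedding m (N • Pi.single i 1) := by
    ext j
    by_cases h : j = i <;> simp [intEmbedding, Pi.single_apply, h, hN']
  rw [heq]
  exact smul_mem _ _ (subset_span hmem)

/-- Every `w` in `M` mod `N` is congruent to some `l` in `L`, so `x ⬝ᵥ w` is congruent to `x ⬝ᵥ l =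
0`. -/
lemma mem_orthogonalMod_of_subsetMod {m : ℕ} {N : ℤ} {M L : Submodule ℤ (Fin m → ℤ)}
    (h : SubsetMod N M L) {x : Fin m → ℤ} (hx : ∀ l ∈ L, x ⬝ᵥ l = 0) :
    x ∈ orthogonalMod N M := by
  rintro w ⟨u, hu, hwu⟩
  obtain ⟨l, hl, hul⟩ := h u hu
  have hwl : x ⬝ᵥ w = x ⬝ᵥ (w - l) := by rw [dotProduct_sub, hx l hl, sub_zero]
  rw [hwl]
  refine Finset.dvd_sum fun i _ => Dvd.dvd.mul_left ?_ _
  have := dvd_add (hwu i) (hul i)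
  simpa using this

/-- AM-GM applied to the squared norms. -/
lemma prod_sq_le_pow_of_basisSize_le {m n : ℕ} (hn : 0 < n) {L : Submodule ℤ (Fin m → ℤ)}
    (b : Basis (Fin n) ℤ L) {μ : ℝ} (hμ : 0 ≤ μ) (hb : basisSize b ≤ μ) :
    (∏ i, ‖intEmbedding m (b i)‖) ^ 2 ≤ μ ^ (2 * n) := by
  have hn' : (n : ℝ) ≠ 0 := by positivity
  have hsum : (1 / (n : ℝ)) * ∑ i, ‖intEmbedding m (b i)‖ ^ 2 ≤ μ ^ 2 :=
    (Real.sqrt_le_left hμ).1 hb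
  have hamgm := Real.geom_mean_le_arith_mean_weighted Finset.univ (fun _ : Fin n => 1 / (n : ℝ))
    (fun i => ‖intEmbedding m (b i)‖ ^ 2) (fun _ _ => by positivity) (by simp [hn'])
    (fun _ _ => by positivity)
  rw [← Finset.mul_sum, Real.finsetProd_rpow _ _ fun _ _ => by positivity] at hamgm
  have hpow := pow_le_pow_left₀ (by positivity) (hamgm.trans hsum) n
  rw [← Real.rpow_natCast _ n, ← Real.rpow_mul (by positivity), one_div_mul_cancel hn',
    Real.rpow_one, ← pow_mul, Finset.prod_pow] at hpow
  exact hpow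

/-- The product of all successive minima is at least the covolume. -/
lemma IsGreedy.covolume_le_prod_norm {m : ℕ} {Λ : Submodule ℤ (EuclideanSpace ℝ (Fin m))}
    [DiscreteTopology Λ] [IsZLattice ℝ Λ] {w : ℕ → EuclideanSpace ℝ (Fin m)}
    (h : IsGreedy Λ m w) : ZLattice.covolume Λ ≤ ∏ i ∈ Finset.range m, ‖w i‖ := by
  rw [← Fin.prod_univ_eq_prod_range fun i => ‖w i‖]
  let f := EuclideanSpace.basisFun (Fin m) ℝ
  exact (covolume_le_abs_det Λ f (fun i => w i) (fun i => (h i i.2).1) h.linearIndependent).trans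
    (abs_det_le_prod_norm f _)

lemma prod_Icc_one_eq_prod_range (g : ℕ → ℝ) (d : ℕ) :
    ∏ k ∈ Finset.Icc 1 d, g k = ∏ i ∈ Finset.range d, g (i + 1) := by
  induction d with
  | zero => simp
  | succ d ih => rw [Finset.prod_Icc_succ_top (by omega), ih, Finset.prod_range_succ]

/-- The first successive minima of a lattice are bounded by those of a lattice in a subspace. -/
lemma prod_successiveMinimum_sq_le {m d : ℕ} {Λ : Submodule ℤ (EuclideanSpace ℝ (Fin m))}
    {W : Submodule ℝ (EuclideanSpace ℝ (Fin m))} (f : OrthonormalBasis (Fin d) ℝ W)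
    (c : Basis (Fin d) ℝ W) (hc : ∀ i, (c i : EuclideanSpace ℝ (Fin m)) ∈ Λ) :
    (∏ k ∈ Finset.Icc 1 d, successiveMinimum Λ k) ^ 2 ≤
      hermiteConstant d ^ d * f.toBasis.det c ^ 2 := by
  obtain ⟨u, hu⟩ := exists_isGreedy (span ℤ (Set.range c))
    (IsZLattice.span_top (K := ℝ) (L := span ℤ (Set.range c))) d
    ((finrank_eq_card_basis c).trans (Fintype.card_fin d)).ge
  have hsub : ∀ x ∈ span ℤ (Set.range c), (x : EuclideanSpace ℝ (Fin m)) ∈ Λ := by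
    have : span ℤ (Set.range c) ≤ Λ.comap (W.subtype.restrictScalars ℤ) := by
      rw [span_le]
      rintro _ ⟨i, rfl⟩
      exact hc i
    exact fun x hx => this hx
  refine le_trans ?_ (hu.prod_norm_sq_le f c)
  rw [prod_Icc_one_eq_prod_range, Finset.prod_range]
  -- The first `k + 1` greedy vectors of the sublattice are independent vectors of `Λ` of norm at
  -- most `‖u k‖`.
  have hle : ∀ k : Fin d, successiveMinimum Λ (k + 1) ≤ ‖u k‖ := fun k => by
    have hk := hu.mono (show (k : ℕ) + 1 ≤ d from k.2)
    refine successiveMinimum_le (norm_nonneg _) (fun i => (u i : EuclideanSpace ℝ (Fin m)))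
      (fun i => hsub _ (hk i i.2).1) (hk.linearIndependent.map' W.subtype (ker_subtype _))
      fun i => hk.norm_le (by omega) (by omega)
  gcongr with k
  · exact Finset.prod_nonneg fun k _ => successiveMinimum_nonneg _ _
  · exact fun k _ => successiveMinimum_nonneg _ _
  · exact hle k

end HiddenLattice

/-! ### Assembling the inequality. -/

open HiddenLattice Module Submodule in
theorem mainTheorem8 (m n r : ℕ) (hn : 0 < n) (hnm : n ≤ m) (μ : ℝ) (hμ : 1 ≤ μ)
    (N : ℤ) (hN : 0 < N)
    (M : Submodule ℤ (Fin m → ℤ)) (hM : Module.finrank ℤ M = r)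
    (hvol : ZLattice.covolume
      (HiddenLattice.toEuclidean (HiddenLattice.orthogonalMod N M)) = (N : ℝ) ^ r)
    (hL : ∃ L : Submodule ℤ (Fin m → ℤ), Module.finrank ℤ L = n ∧
      HiddenLattice.IsSmall μ L ∧ HiddenLattice.SubsetMod N M L) :
    (∏ k ∈ Finset.Icc (m - n + 1) m, HiddenLattice.successiveMinimum
        (HiddenLattice.toEuclidean (HiddenLattice.orthogonalMod N M)) k) /
      (∏ k ∈ Finset.Icc 1 (m - n), HiddenLattice.successiveMinimum
        (HiddenLattice.toEuclidean (HiddenLattice.orthogonalMod N M)) k) ≥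
    HiddenLattice.hermiteConstant (m - n) ^ (-((m : ℤ) - (n : ℤ))) *
      ((N : ℝ) ^ r / μ ^ (2 * n)) := by
  obtain ⟨L, hLn, hsmall, hML⟩ := hL
  obtain ⟨b, hb⟩ : ∃ b : Basis (Fin n) ℤ L, basisSize b ≤ μ := by
    subst hLn
    exact hsmall
  set d := m - n with hd
  set Λ := toEuclidean (orthogonalMod N M) with hΛ
  have : IsZLattice ℝ Λ := isZLattice_toEuclidean_orthogonalMod hN M
  obtain ⟨W, f, c, a, hca, hav, hdet⟩ := exists_orthogonal_lattice
    (fun i => (b i : Fin m → ℤ)) (b.linearIndependent.map' L.subtype (ker_subtype _))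
  have haΛ : ∀ i, (c i : EuclideanSpace ℝ (Fin m)) ∈ Λ := by
    intro i
    rw [hca]
    refine mem_map_of_mem (mem_orthogonalMod_of_subsetMod hML fun l hl => ?_)
    have hl' : l = ∑ j, b.repr ⟨l, hl⟩ j • (b j : Fin m → ℤ) := by
      have := congrArg L.subtype (b.sum_repr ⟨l, hl⟩)
      rw [map_sum] at this
      exact this.symm
    rw [hl', dotProduct_sum]
    refine Finset.sum_eq_zero fun j _ => ?_
    rw [dotProduct_smul, dotProduct_comm, hav, smul_zero]
  obtain ⟨w, hw⟩ := exists_isGreedy Λ (IsZLattice.span_top (K := ℝ) (L := Λ)) m (by simp)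
  have hmin : ∀ k < m, successiveMinimum Λ (k + 1) = ‖w k‖ := fun k hk =>
    (hw.mono (show k + 1 ≤ m from hk)).successiveMinimum_eq
  have hpos : ∀ k ∈ Finset.Icc 1 m, 0 < successiveMinimum Λ k := by
    intro k hk
    obtain ⟨k, rfl⟩ := Nat.exists_eq_add_of_le' (Finset.mem_Icc.1 hk).1
    have hkm : k < m := (Finset.mem_Icc.1 hk).2
    rw [hmin k hkm]
    exact hw.norm_pos hkm
  have hall : (N : ℝ) ^ r ≤ ∏ k ∈ Finset.Icc 1 m, successiveMinimum Λ k := by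
    rw [prod_Icc_one_eq_prod_range, ← hvol,
      Finset.prod_congr rfl fun k hk => hmin k (Finset.mem_range.1 hk)]
    exact hw.covolume_le_prod_norm
  have hsplit : (∏ k ∈ Finset.Icc 1 d, successiveMinimum Λ k) *
      ∏ k ∈ Finset.Icc (d + 1) m, successiveMinimum Λ k =
      ∏ k ∈ Finset.Icc 1 m, successiveMinimum Λ k := by
    have h := Finset.prod_Ioc_consecutive (fun k => successiveMinimum Λ k) (Nat.zero_le d)
      (Nat.sub_le m n)
    simpa only [← Finset.Icc_add_one_left_eq_Ioc, zero_add] using h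
  have hfirst : 0 < ∏ k ∈ Finset.Icc 1 d, successiveMinimum Λ k :=
    Finset.prod_pos fun k hk => hpos k (Finset.Icc_subset_Icc_right (Nat.sub_le m n) hk)
  have hsq := prod_successiveMinimum_sq_le f c haΛ
  -- Positivity is read off from `hsq`, whose left side is positive; this also covers `d = 0`.
  have hγ : 0 < hermiteConstant d ^ d :=
    pos_of_mul_pos_left ((pow_pos hfirst 2).trans_le hsq) (sq_nonneg _)
  have hdetμ : f.toBasis.det c ^ 2 ≤ μ ^ (2 * n) := by
    rw [← sq_abs]
    exact (pow_le_pow_left₀ (abs_nonneg _) hdet 2).trans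
      (prod_sq_le_pow_of_basisSize_le hn b (by linarith) hb)
  have hsq' := hsq.trans (mul_le_mul_of_nonneg_left hdetμ hγ.le)
  have hexp : hermiteConstant d ^ (-((m : ℤ) - (n : ℤ))) = (hermiteConstant d ^ d)⁻¹ := by
    rw [← Nat.cast_sub hnm, zpow_neg, zpow_natCast]
  rw [ge_iff_le, hexp, ← div_eq_inv_mul, div_div, div_le_div_iff₀ (by positivity) hfirst,
    mul_comm (μ ^ (2 * n))]
  set P := ∏ k ∈ Finset.Icc 1 d, successiveMinimum Λ k
  set Q := ∏ k ∈ Finset.Icc (d + 1) m, successiveMinimum Λ k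
  have hQ : 0 < Q := Finset.prod_pos fun k hk => hpos k
    (Finset.Icc_subset_Icc_left (Nat.le_add_left 1 d) hk)
  calc (N : ℝ) ^ r * P ≤ P * Q * P := mul_le_mul_of_nonneg_right (hall.trans_eq hsplit.symm)
        hfirst.le
    _ = Q * P ^ 2 := by ring
    _ ≤ Q * (hermiteConstant d ^ d * μ ^ (2 * n)) := mul_le_mul_of_nonneg_left hsq' hQ.le
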